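/- **Theorem.** Let $\ell\ge 1$ be an integer, $\lambda>0$, and let indices $i$ be taken modulo $\ell$ in $\{1,\dots,\ell\}$. For a magnetic field $\underline h=(h_1,\dots,h_\ell)\in\mathbb R^\ell$ let $$Z_{\ell,\underline h}=\sum_{\sigma\in\{-1,1\}^{\ell}}\exp\Big(\sum_{i=1}^{\ell}\{\lambda\sigma(i)\sigma(i+1)+h_i\sigma(i)\}\Big),\qquad Z^*_{\ell,\underline h}=Z_{\ell,\underline h}\prod_{i=1}^{\ell}(e^{h_i}+e^{-h_i})^{-1},\qquad m_i=\frac{\partial}{\partial h_i}\log Z_{\ell,\underline h},$$ and, for $h_{\rm ext}\in\mathbb R$, define the effective hamiltonian $$H^{\rm eff}_{\ell,\underline h}=-\sum_{i=1}^{\ell}\Big\{\frac{m_i^2}{2}-h_im_i+h_{\rm ext}m_i+\log(e^{h_i}+e^{-h_i})\Big\}-\log Z^*_{\ell,\underline h}+A_0,$$ where $A_0=\log Z^*_{\ell,\underline 0}$ is the constant term of the expansion of $\log Z^*_{\ell,\underline h}$ in powers of $u_i=\tanh h_i$. Let $h_0=\frac14\left[\frac12-\frac38\right]=\frac1{32}$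 and let $h^*\ge 3$ be the solution of $3/\cosh^2(h^*-3)=\frac14$. Let $h_+>0$. There is $\lambda_0>0$, depending only on $h_+$, such that for all $\lambda\in(0,\lambda_0)$, all $h_{\rm ext}\in[h_0,h^*]$ and all $\ell\ge1$, the infimum of $H^{\rm eff}_{\ell,\underline h}$ over all $\underline h$ with $|h_i|\le h_+$ for every $i$ (equivalently $|u_i|\le\tanh h_+$) is finite and equal to the minimum, which is attained, of $H^{\rm eff}_{\ell,\underline h}$ over the homogeneous fields $\underline h=(h,\dots,h)$ with $|h|\le h_+$. -/

import Mathlib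

noncomputable section

namespace KacIsing

/-- The threshold `h₀ = (1/4) (1/2 - 3/8)`. -/
def h0 : ℝ := (1 / 4) * (1 / 2 - 3 / 8)

/-- The field `h*`: the (larger) solution of `3 / cosh² (h* - 3) = 1/4`,
see `hstar_eq` and `three_le_hstar`. -/
def hstar : ℝ := 3 + Real.arcosh (Real.sqrt 12)

theorem three_le_hstar : 3 ≤ hstar := by
  have h : (1 : ℝ) ≤ Real.sqrt 12 := Real.one_le_sqrt.2 (by norm_num)
  have := Real.arcosh_nonneg h
  unfold hstar; linarith

theorem hstar_eq : 3 / Real.cosh (hstar - 3) ^ 2 = 1 / 4 := by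
  have h : (1 : ℝ) ≤ Real.sqrt 12 := Real.one_le_sqrt.2 (by norm_num)
  have h2 : hstar - 3 = Real.arcosh (Real.sqrt 12) := by unfold hstar; ring
  rw [h2, Real.cosh_arcosh h, Real.sq_sqrt (by norm_num)]
  norm_num

/-- Partition function `Z_{ℓ,h}` of the one-dimensional Ising model on the cycle of `ℓ` sites
(indices in `Fin ℓ`, so that `i + 1` is taken modulo `ℓ`; spins in `ℤˣ = {1, -1}`), with
nearest neighbour coupling `lam` and site dependent magnetic field `h`. -/
def Z {ℓ : ℕ} [NeZero ℓ] (lam : ℝ) (h : Fin ℓ → ℝ) : ℝ :=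
  ∑ σ : Fin ℓ → ℤˣ,
    Real.exp (∑ i, (lam * ((σ i : ℤ) : ℝ) * ((σ (i + 1) : ℤ) : ℝ) + h i * ((σ i : ℤ) : ℝ)))

/-- The normalized partition function `Z*_{ℓ,h} = Z_{ℓ,h} / ∏ᵢ (e^{hᵢ} + e^{-hᵢ})`. -/
def Zstar {ℓ : ℕ} [NeZero ℓ] (lam : ℝ) (h : Fin ℓ → ℝ) : ℝ :=
  Z lam h * (∏ i, (Real.exp (h i) + Real.exp (-h i)))⁻¹

/-- The magnetization `mᵢ = ∂ log Z_{ℓ,h} / ∂ hᵢ`. -/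
def mag {ℓ : ℕ} [NeZero ℓ] (lam : ℝ) (h : Fin ℓ → ℝ) (i : Fin ℓ) : ℝ :=
  deriv (fun s : ℝ => Real.log (Z lam (Function.update h i s))) (h i)

/-- The constant term `A₀` of the expansion of `log Z*_{ℓ,h}` in powers of the variables
`uᵢ = tanh hᵢ`, that is, the value of `log Z*_{ℓ,h}` at `u = 0`, which is `h = 0`. -/
def A0 (ℓ : ℕ) [NeZero ℓ] (lam : ℝ) : ℝ :=
  Real.log (Zstar lam (0 : Fin ℓ → ℝ))

/-- The effective hamiltonian `H^eff_{ℓ,h}`. -/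
def Heff {ℓ : ℕ} [NeZero ℓ] (lam hext : ℝ) (h : Fin ℓ → ℝ) : ℝ :=
  (∑ i, (-(mag lam h i ^ 2 / 2 - h i * mag lam h i + hext * mag lam h i)
      - Real.log (Real.exp (h i) + Real.exp (-h i))))
    - Real.log (Zstar lam h) + A0 ℓ lam

/-- The fields all of whose components are bounded by `hplus` in absolute value; in the
variables `uᵢ = tanh hᵢ` this is `|uᵢ| ≤ tanh hplus` for all `i`. -/
def fieldBox (ℓ : ℕ) (hplus : ℝ) : Set (Fin ℓ → ℝ) :=
  {h | ∀ i, |h i| ≤ hplus}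

/-- The homogeneous fields: all components are equal to each other. -/
def homogeneousFields (ℓ : ℕ) : Set (Fin ℓ → ℝ) :=
  {h | ∀ i j, h i = h j}

end KacIsing

end

noncomputable section

namespace KacIsing

/-! A minimizer over the compact box exists; it is shown to be homogeneous. With `mᵢ` the mean spin,
`eᵢ = hᵢ - mᵢ - hext` and `c` the spin covariance matrix, the gradient of the effective hamiltonian
is `∑ᵢ eᵢ cᵢⱼ` (`hasDerivAt_Heff_update`). FKG gives `cᵢⱼ ≥ 0`, and the single-site DLR equation
gives off-diagonal column sums at most `4 lam` (`sum_spinCov_le`), uniformly in `ℓ`. Hence the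
gradient at `j` is `χⱼ eⱼ`, with `χⱼ = ∑ᵢ cᵢⱼ` bounded below, up to an error `12 lam δ`, where `δ =
max h - min h`.

Suppose `δ > 0` at a minimizer, with maximum at `M` and minimum at `N`. Lowering `h M` or raising `h
N` stays in the box, so `e_M ≤ O(lam δ)` and `e_N ≥ -O(lam δ)`. As `hext ≥ 1/32`, the second bound
keeps `h N` away from `0`; there magnetization is a strict contraction of the field, so `e_M - e_N ≥
(tanh² (1/64) - 4 lam) δ`. For small `lam` this contradicts the first two bounds. -/

theorem hasDerivAt_tanh (x : ℝ) : HasDerivAt Real.tanh (1 - Real.tanh x ^ 2) x := by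
  have hc : Real.cosh x ≠ 0 := (Real.cosh_pos x).ne'
  have h := (Real.hasDerivAt_sinh x).div (Real.hasDerivAt_cosh x) hc
  have he : Real.tanh = fun y => Real.sinh y / Real.cosh y :=
    funext Real.tanh_eq_sinh_div_cosh
  rw [he]
  refine h.congr_deriv ?_
  change _ = 1 - (Real.sinh x / Real.cosh x) ^ 2
  field_simp

theorem strictMono_tanh : StrictMono Real.tanh :=
  strictMono_of_hasDerivAt_pos hasDerivAt_tanh fun x => by linarith [Real.tanh_sq_lt_one x]

theorem monotone_sub_tanh : Monotone fun x : ℝ => x - Real.tanh x :=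
  monotone_of_hasDerivAt_nonneg (fun x => (hasDerivAt_id x).sub (hasDerivAt_tanh x))
    fun x => by simpa using sq_nonneg (Real.tanh x)

theorem exp_mul_one_sub_tanh (x : ℝ) :
    (1 - Real.tanh x) + Real.exp (-(2 * x)) * (-1 - Real.tanh x) = 0 := by
  have h1 : Real.exp (-(2 * x)) = Real.exp (-x) * Real.exp (-x) := by
    rw [← Real.exp_add]; ring_nf
  have h2 : Real.exp x * Real.exp (-x) = 1 := by rw [← Real.exp_add]; simp
  have h3 : 0 < Real.exp x + Real.exp (-x) := by positivity
  rw [Real.tanh_eq, h1]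
  field_simp
  linear_combination (-2 * Real.exp (-x)) * h2

/-! ### Gibbs expectations and their derivatives in the field. -/

section Gibbs

variable {ℓ : ℕ}

/-- The real value of the spin at the site `i`. -/
def spin (σ : Fin ℓ → ℤˣ) (i : Fin ℓ) : ℝ := ((σ i : ℤ) : ℝ)

theorem spin_eq (σ : Fin ℓ → ℤˣ) (i : Fin ℓ) : spin σ i = 1 ∨ spin σ i = -1 := by
  unfold spin
  rcases Int.units_eq_one_or (σ i) with h | h <;> simp [h]

theorem spin_sq (σ : Fin ℓ → ℤˣ) (i : Fin ℓ) : spin σ i * spin σ i = 1 := by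
  rcases spin_eq σ i with h | h <;> simp [h]

theorem neg_one_le_spin (σ : Fin ℓ → ℤˣ) (i : Fin ℓ) : -1 ≤ spin σ i := by
  rcases spin_eq σ i with h | h <;> simp [h]

theorem spin_le_one (σ : Fin ℓ → ℤˣ) (i : Fin ℓ) : spin σ i ≤ 1 := by
  rcases spin_eq σ i with h | h <;> simp [h]

theorem monotone_spin (i : Fin ℓ) : Monotone fun σ : Fin ℓ → ℤˣ => spin σ i := fun _ _ h =>
  Int.cast_le.2 (Units.val_le_val.2 (h i))

theorem hasDerivAt_update (h : Fin ℓ → ℝ) (j : Fin ℓ) (t : ℝ) (i : Fin ℓ) :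
    HasDerivAt (fun s => Function.update h j s i) ((Pi.single j 1 : Fin ℓ → ℝ) i) t := by
  rcases eq_or_ne i j with rfl | hij
  · simpa using hasDerivAt_id' t
  · simpa [hij] using hasDerivAt_const t (h i)

variable [NeZero ℓ]

/-- The Gibbs weight of a configuration. -/
def weight (lam : ℝ) (h : Fin ℓ → ℝ) (σ : Fin ℓ → ℤˣ) : ℝ :=
  Real.exp (∑ i, (lam * spin σ i * spin σ (i + 1) + h i * spin σ i))

theorem weight_pos (lam : ℝ) (h : Fin ℓ → ℝ) (σ : Fin ℓ → ℤˣ) : 0 < weight lam h σ :=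
  Real.exp_pos _

theorem Z_eq_sum_weight (lam : ℝ) (h : Fin ℓ → ℝ) : Z lam h = ∑ σ, weight lam h σ := rfl

theorem Z_pos (lam : ℝ) (h : Fin ℓ → ℝ) : 0 < Z lam h :=
  Finset.sum_pos (fun _ _ => Real.exp_pos _) Finset.univ_nonempty

/-- The Gibbs expectation. -/
def gibbs (lam : ℝ) (h : Fin ℓ → ℝ) (f : (Fin ℓ → ℤˣ) → ℝ) : ℝ :=
  (∑ σ, weight lam h σ * f σ) / Z lam h

/-- The Gibbs covariance. -/
def cov (lam : ℝ) (h : Fin ℓ → ℝ) (f g : (Fin ℓ → ℤˣ) → ℝ) : ℝ :=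
  gibbs lam h (fun σ => f σ * g σ) - gibbs lam h f * gibbs lam h g

section
variable (lam : ℝ) (h : Fin ℓ → ℝ)

theorem gibbs_const (c : ℝ) : gibbs lam h (fun _ => c) = c := by
  unfold gibbs
  rw [← Finset.sum_mul, ← Z_eq_sum_weight, mul_div_cancel_left₀ _ (Z_pos lam h).ne']

theorem gibbs_add (f g : (Fin ℓ → ℤˣ) → ℝ) :
    gibbs lam h (fun σ => f σ + g σ) = gibbs lam h f + gibbs lam h g := by
  simp only [gibbs, mul_add, Finset.sum_add_distrib, add_div]

theorem gibbs_sub (f g : (Fin ℓ → ℤˣ) → ℝ) :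
    gibbs lam h (fun σ => f σ - g σ) = gibbs lam h f - gibbs lam h g := by
  simp only [gibbs, mul_sub, Finset.sum_sub_distrib, sub_div]

theorem gibbs_const_mul (c : ℝ) (f : (Fin ℓ → ℤˣ) → ℝ) :
    gibbs lam h (fun σ => c * f σ) = c * gibbs lam h f := by
  simp only [gibbs, mul_left_comm _ c, ← Finset.mul_sum, mul_div_assoc]

theorem gibbs_sum (c : Fin ℓ → ℝ) (f : Fin ℓ → (Fin ℓ → ℤˣ) → ℝ) :
    gibbs lam h (fun σ => ∑ i, c i * f i σ) = ∑ i, c i * gibbs lam h (f i) := by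
  simp only [← gibbs_const_mul]
  simp only [gibbs, ← Finset.sum_div, Finset.mul_sum]
  rw [Finset.sum_comm]

theorem gibbs_mono {f g : (Fin ℓ → ℤˣ) → ℝ} (hfg : ∀ σ, f σ ≤ g σ) :
    gibbs lam h f ≤ gibbs lam h g :=
  div_le_div_of_nonneg_right
    (Finset.sum_le_sum fun σ _ => mul_le_mul_of_nonneg_left (hfg σ) (weight_pos lam h σ).le)
    (Z_pos lam h).le

theorem cov_spin_comm (i j : Fin ℓ) :
    cov lam h (fun σ => spin σ i) (fun σ => spin σ j) =
      cov lam h (fun σ => spin σ j) (fun σ => spin σ i) := by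
  simp only [cov, mul_comm]

theorem cov_sum (f : (Fin ℓ → ℤˣ) → ℝ) (c : Fin ℓ → ℝ) (g : Fin ℓ → (Fin ℓ → ℤˣ) → ℝ) :
    cov lam h f (fun σ => ∑ i, c i * g i σ) = ∑ i, c i * cov lam h f (g i) := by
  have h1 : (fun σ => f σ * ∑ i, c i * g i σ) = fun σ => ∑ i, c i * (f σ * g i σ) := by
    funext σ; rw [Finset.mul_sum]; exact Finset.sum_congr rfl fun i _ => by ring
  rw [cov, h1, gibbs_sum, gibbs_sum, Finset.mul_sum, ← Finset.sum_sub_distrib]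
  exact Finset.sum_congr rfl fun i _ => by rw [cov]; ring

end

section Derivative
variable {lam : ℝ} {γ : ℝ → Fin ℓ → ℝ} {γ' : Fin ℓ → ℝ} {t : ℝ}

theorem hasDerivAt_weight (hγ : ∀ i, HasDerivAt (fun s => γ s i) (γ' i) t) (σ : Fin ℓ → ℤˣ) :
    HasDerivAt (fun s => weight lam (γ s) σ) (weight lam (γ t) σ * ∑ i, γ' i * spin σ i) t := by
  refine HasDerivAt.exp (HasDerivAt.fun_sum fun i _ => ?_)
  exact ((hγ i).mul_const _).const_add _

theorem hasDerivAt_Z (hγ : ∀ i, HasDerivAt (fun s => γ s i) (γ' i) t) :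
    HasDerivAt (fun s => Z lam (γ s)) (∑ σ, weight lam (γ t) σ * ∑ i, γ' i * spin σ i) t :=
  HasDerivAt.fun_sum fun σ _ => hasDerivAt_weight hγ σ

theorem hasDerivAt_log_Z (hγ : ∀ i, HasDerivAt (fun s => γ s i) (γ' i) t) :
    HasDerivAt (fun s => Real.log (Z lam (γ s)))
      (∑ i, γ' i * gibbs lam (γ t) (fun σ => spin σ i)) t := by
  rw [← gibbs_sum]
  exact (hasDerivAt_Z hγ).log (Z_pos _ _).ne'

theorem hasDerivAt_gibbs (hγ : ∀ i, HasDerivAt (fun s => γ s i) (γ' i) t)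
    (f : (Fin ℓ → ℤˣ) → ℝ) :
    HasDerivAt (fun s => gibbs lam (γ s) f)
      (∑ i, γ' i * cov lam (γ t) f (fun σ => spin σ i)) t := by
  rw [← cov_sum]
  have h1 : HasDerivAt (fun s => ∑ σ, weight lam (γ s) σ * f σ)
      (∑ σ, weight lam (γ t) σ * (∑ i, γ' i * spin σ i) * f σ) t :=
    HasDerivAt.fun_sum fun σ _ => (hasDerivAt_weight hγ σ).mul_const _
  have hZ := (Z_pos lam (γ t)).ne'
  have h2 := h1.fun_div (hasDerivAt_Z hγ) hZ
  refine h2.congr_deriv ?_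
  have h3 : ∑ σ, weight lam (γ t) σ * (∑ i, γ' i * spin σ i) * f σ =
      ∑ σ, weight lam (γ t) σ * (f σ * ∑ i, γ' i * spin σ i) :=
    Finset.sum_congr rfl fun σ _ => by ring
  rw [h3]
  unfold cov gibbs
  field_simp

end Derivative

theorem mag_eq_gibbs (lam : ℝ) (h : Fin ℓ → ℝ) (i : Fin ℓ) :
    mag lam h i = gibbs lam h (fun σ => spin σ i) := by
  have := hasDerivAt_log_Z (lam := lam) (hasDerivAt_update h i (h i))
  rw [mag, this.deriv]
  simp [Pi.single_apply]

/-- The single-site terms `log (e^{hᵢ} + e^{-hᵢ})` cancel against the normalization of `Zstar`. -/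
theorem Heff_eq (lam hext : ℝ) (h : Fin ℓ → ℝ) :
    Heff lam hext h = (∑ i, (-(gibbs lam h (fun σ => spin σ i) ^ 2 / 2) +
      (h i - hext) * gibbs lam h (fun σ => spin σ i))) - Real.log (Z lam h) + A0 ℓ lam := by
  have hp : ∀ i ∈ Finset.univ, Real.exp (h i) + Real.exp (-h i) ≠ 0 := fun i _ => by positivity
  rw [Heff, Zstar, Real.log_mul (Z_pos _ _).ne' (inv_ne_zero (Finset.prod_ne_zero_iff.2 hp)),
    Real.log_inv, Real.log_prod hp]
  simp only [mag_eq_gibbs, Finset.sum_sub_distrib]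
  have : ∀ i, -(gibbs lam h (fun σ => spin σ i) ^ 2 / 2 - h i * gibbs lam h (fun σ => spin σ i)
      + hext * gibbs lam h (fun σ => spin σ i)) = -(gibbs lam h (fun σ => spin σ i) ^ 2 / 2) +
      (h i - hext) * gibbs lam h (fun σ => spin σ i) := fun i => by ring
  simp only [this]
  ring

/-- The derivative of `log Z` cancels the term produced by differentiating the explicit factor `hᵢ`,
so only derivatives of the magnetizations, which are covariances, remain. -/
theorem hasDerivAt_Heff_update (lam hext : ℝ) (h : Fin ℓ → ℝ) (j : Fin ℓ) :
    HasDerivAt (fun s => Heff lam hext (Function.update h j s))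
      (∑ i, (h i - gibbs lam h (fun σ => spin σ i) - hext) *
        cov lam h (fun σ => spin σ i) (fun σ => spin σ j)) (h j) := by
  simp only [Heff_eq]
  have hu := hasDerivAt_update h j (h j)
  have hg := fun i => hasDerivAt_gibbs (lam := lam) hu (fun σ => spin σ i)
  have h1 := HasDerivAt.fun_sum (u := Finset.univ) fun i _ =>
    (((hg i).fun_pow 2).div_const 2).fun_neg.fun_add (((hu i).sub_const hext).fun_mul (hg i))
  refine ((h1.fun_sub (hasDerivAt_log_Z hu)).add_const _).congr_deriv ?_
  simp only [Function.update_eq_self, ← Finset.sum_sub_distrib]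
  refine Finset.sum_congr rfl fun i _ => ?_
  have h2 : ∑ k, (Pi.single j 1 : Fin ℓ → ℝ) k *
      cov lam h (fun σ => spin σ i) (fun σ => spin σ k) =
      cov lam h (fun σ => spin σ i) (fun σ => spin σ j) := by simp [Pi.single_apply]
  rw [h2]
  push_cast
  ring

theorem continuous_weight (lam : ℝ) (σ : Fin ℓ → ℤˣ) :
    Continuous fun h => weight lam h σ := by
  unfold weight; fun_prop

theorem continuous_Z (lam : ℝ) : Continuous fun h : Fin ℓ → ℝ => Z lam h :=
  continuous_finsetSum _ fun σ _ => continuous_weight lam σ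

theorem continuous_gibbs (lam : ℝ) (f : (Fin ℓ → ℤˣ) → ℝ) :
    Continuous fun h => gibbs lam h f :=
  (continuous_finsetSum _ fun σ _ => (continuous_weight lam σ).mul continuous_const).div
    (continuous_Z lam) fun h => (Z_pos lam h).ne'

theorem continuous_Heff (lam hext : ℝ) :
    Continuous fun h : Fin ℓ → ℝ => Heff lam hext h := by
  simp only [Heff_eq]
  have h1 := fun i => continuous_gibbs lam (fun σ : Fin ℓ → ℤˣ => spin σ i)
  have h2 := (continuous_Z (ℓ := ℓ) lam).log fun h => (Z_pos lam h).ne'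
  fun_prop

end Gibbs

/-! ### FKG, the DLR equation and decay of correlations. -/

section Correlations

variable {ℓ : ℕ}

/-- The configuration with the spin at `i` reversed. -/
def flip (i : Fin ℓ) (σ : Fin ℓ → ℤˣ) : Fin ℓ → ℤˣ := Function.update σ i (-σ i)

theorem flip_flip (i : Fin ℓ) (σ : Fin ℓ → ℤˣ) : flip i (flip i σ) = σ := by
  simp [flip]

theorem spin_flip (i k : Fin ℓ) (σ : Fin ℓ → ℤˣ) :
    spin (flip i σ) k = spin σ k - 2 * (if k = i then spin σ i else 0) := by
  unfold flip spin
  split_ifs with hk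
  · subst hk; simp; ring
  · simp [hk]

theorem spin_flip_self (i : Fin ℓ) (σ : Fin ℓ → ℤˣ) : spin (flip i σ) i = -spin σ i := by
  rw [spin_flip, if_pos rfl]; ring

theorem spin_flip_of_ne {i k : Fin ℓ} (hk : k ≠ i) (σ : Fin ℓ → ℤˣ) :
    spin (flip i σ) k = spin σ k := by
  rw [spin_flip, if_neg hk]; ring

variable [NeZero ℓ]

theorem weight_mul_weight_le {lam : ℝ} (hlam : 0 ≤ lam) (h : Fin ℓ → ℝ) (σ τ : Fin ℓ → ℤˣ) :
    weight lam h σ * weight lam h τ ≤ weight lam h (σ ⊓ τ) * weight lam h (σ ⊔ τ) := by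
  unfold weight
  rw [← Real.exp_add, ← Real.exp_add, Real.exp_le_exp, ← Finset.sum_add_distrib,
    ← Finset.sum_add_distrib]
  refine Finset.sum_le_sum fun i _ => ?_
  have key : ∀ k, (spin σ k ≤ spin τ k ∧ spin (σ ⊓ τ) k = spin σ k ∧ spin (σ ⊔ τ) k = spin τ k) ∨
      (spin τ k ≤ spin σ k ∧ spin (σ ⊓ τ) k = spin τ k ∧ spin (σ ⊔ τ) k = spin σ k) := by
    intro k
    have hcast : ∀ u v : ℤˣ, u ≤ v → ((u : ℤ) : ℝ) ≤ ((v : ℤ) : ℝ) := fun u v huv =>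
      Int.cast_le.2 (Units.val_le_val.2 huv)
    rcases le_total (σ k) (τ k) with hk | hk
    · left; exact ⟨hcast _ _ hk, by simp [spin, hk], by simp [spin, hk]⟩
    · right; exact ⟨hcast _ _ hk, by simp [spin, hk], by simp [spin, hk]⟩
  rcases key i with ⟨h1, h2, h3⟩ | ⟨h1, h2, h3⟩ <;>
    rcases key (i + 1) with ⟨h4, h5, h6⟩ | ⟨h4, h5, h6⟩ <;>
    rw [h2, h3, h5, h6] <;>
    linarith [mul_nonneg hlam (mul_nonneg (sub_nonneg.2 h1) (sub_nonneg.2 h4))]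

/-- The FKG inequality for the Gibbs measure. -/
theorem cov_nonneg {lam : ℝ} (hlam : 0 ≤ lam) (h : Fin ℓ → ℝ) {f g : (Fin ℓ → ℤˣ) → ℝ}
    (hf : Monotone f) (hg : Monotone g) : 0 ≤ cov lam h f g := by
  -- `fkg` needs nonnegative functions; subtracting constants does not change the covariance.
  obtain ⟨c, hc⟩ := (Set.finite_range f).bddBelow
  obtain ⟨d, hd⟩ := (Set.finite_range g).bddBelow
  have hZ := Z_pos lam h
  have h1 := fkg (μ := weight lam h) (f := fun σ => f σ - c) (g := fun σ => g σ - d)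
    (fun σ => (weight_pos lam h σ).le) (fun σ => sub_nonneg.2 (hc ⟨σ, rfl⟩))
    (fun σ => sub_nonneg.2 (hd ⟨σ, rfl⟩)) (fun σ τ hst => sub_le_sub_right (hf hst) c)
    (fun σ τ hst => sub_le_sub_right (hg hst) d) (weight_mul_weight_le hlam h)
  have h2 : gibbs lam h (fun σ => f σ - c) * gibbs lam h (fun σ => g σ - d) ≤
      gibbs lam h (fun σ => (f σ - c) * (g σ - d)) := by
    unfold gibbs
    rw [div_mul_div_comm, div_le_div_iff₀ (by positivity) hZ, ← mul_assoc]
    exact mul_le_mul_of_nonneg_right (h1.trans_eq (mul_comm _ _)) hZ.le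
  have h3 : (fun σ => (f σ - c) * (g σ - d)) =
      fun σ => f σ * g σ - (c * g σ + (d * f σ - c * d)) := by funext σ; ring
  rw [h3, gibbs_sub, gibbs_sub, gibbs_sub, gibbs_add, gibbs_sub, gibbs_const_mul,
    gibbs_const_mul, gibbs_const, gibbs_const, gibbs_const] at h2
  unfold cov
  linarith

/-- The field felt by the spin at `i`, given the other spins. -/
def localField (lam : ℝ) (h : Fin ℓ → ℝ) (i : Fin ℓ) (σ : Fin ℓ → ℤˣ) : ℝ :=
  h i + lam * (spin σ (i - 1) + spin σ (i + 1))

theorem sub_two_mul_le_localField {lam : ℝ} (hlam : 0 ≤ lam) (h : Fin ℓ → ℝ) (i : Fin ℓ)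
    (σ : Fin ℓ → ℤˣ) : h i - 2 * lam ≤ localField lam h i σ := by
  unfold localField
  nlinarith [neg_one_le_spin σ (i - 1), neg_one_le_spin σ (i + 1)]

theorem localField_le_add_two_mul {lam : ℝ} (hlam : 0 ≤ lam) (h : Fin ℓ → ℝ) (i : Fin ℓ)
    (σ : Fin ℓ → ℤˣ) : localField lam h i σ ≤ h i + 2 * lam := by
  unfold localField
  nlinarith [spin_le_one σ (i - 1), spin_le_one σ (i + 1)]

theorem localField_flip (hℓ : (1 : Fin ℓ) ≠ 0) (lam : ℝ) (h : Fin ℓ → ℝ) (i : Fin ℓ)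
    (σ : Fin ℓ → ℤˣ) : localField lam h i (flip i σ) = localField lam h i σ := by
  unfold localField
  rw [spin_flip_of_ne (by simpa using hℓ), spin_flip_of_ne (by simpa using hℓ)]

theorem weight_flip (hℓ : (1 : Fin ℓ) ≠ 0) (lam : ℝ) (h : Fin ℓ → ℝ) (i : Fin ℓ)
    (σ : Fin ℓ → ℤˣ) :
    weight lam h (flip i σ) =
      weight lam h σ * Real.exp (-(2 * (spin σ i * localField lam h i σ))) := by
  unfold weight
  rw [← Real.exp_add]
  congr 1
  have hterm : ∀ k, lam * spin (flip i σ) k * spin (flip i σ) (k + 1) + h k * spin (flip i σ) k =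
      (lam * spin σ k * spin σ (k + 1) + h k * spin σ k) +
      ((if k = i then -2 * (lam * spin σ i * spin σ (k + 1) + h k * spin σ i) else 0) +
        (if k = i - 1 then -2 * (lam * spin σ k * spin σ i) else 0)) := by
    intro k
    have hk : k + 1 = i ↔ k = i - 1 := eq_sub_iff_add_eq.symm
    rw [spin_flip, spin_flip]
    simp only [hk]
    split_ifs with h1 h2 h2
    -- A site is its own neighbour only when `1 = 0` in `Fin ℓ`, that is `ℓ = 1`.
    · exact absurd (sub_eq_self.1 (h2.symm.trans h1)) hℓ
    · ring
    · ring
    · ring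
  simp only [hterm, Finset.sum_add_distrib, Finset.sum_ite_eq', Finset.mem_univ, if_true,
    localField]
  ring

/-- The single-site DLR equation. -/
theorem gibbs_spin_mul (hℓ : (1 : Fin ℓ) ≠ 0) (lam : ℝ) (h : Fin ℓ → ℝ) (i : Fin ℓ)
    {g : (Fin ℓ → ℤˣ) → ℝ} (hg : ∀ σ, g (flip i σ) = g σ) :
    gibbs lam h (fun σ => spin σ i * g σ) =
      gibbs lam h (fun σ => Real.tanh (localField lam h i σ) * g σ) := by
  rw [← sub_eq_zero, ← gibbs_sub]
  unfold gibbs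
  rw [div_eq_zero_iff]
  left
  set F : (Fin ℓ → ℤˣ) → ℝ := fun σ =>
    weight lam h σ * (spin σ i * g σ - Real.tanh (localField lam h i σ) * g σ) with hF
  have h1 : ∑ σ, F (flip i σ) = ∑ σ, F σ :=
    Equiv.sum_comp (Function.Involutive.toPerm (flip i) (flip_flip i)) F
  -- Given the other spins, the two values of `σ i` have conditional mean `tanh` of the local field,
  -- so each pair cancels.
  have h2 : ∀ σ, F σ + F (flip i σ) = 0 := by
    intro σ
    have hx := exp_mul_one_sub_tanh (localField lam h i σ)
    have hy := exp_mul_one_sub_tanh (-localField lam h i σ)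
    rw [Real.tanh_neg] at hy
    simp only [hF, hg, weight_flip hℓ, localField_flip hℓ, spin_flip_self]
    rcases spin_eq σ i with hs | hs <;> rw [hs]
    · simp only [one_mul]
      generalize Real.exp (-(2 * localField lam h i σ)) = E at hx ⊢
      linear_combination (weight lam h σ * g σ) * hx
    · simp only [neg_one_mul]
      generalize Real.exp (-(2 * -localField lam h i σ)) = E at hy ⊢
      linear_combination (-weight lam h σ * g σ) * hy
  have h3 : ∑ σ, F σ + ∑ σ, F (flip i σ) = 0 := by
    rw [← Finset.sum_add_distrib]; exact Finset.sum_eq_zero fun σ _ => h2 σ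
  linarith

theorem gibbs_spin (hℓ : (1 : Fin ℓ) ≠ 0) (lam : ℝ) (h : Fin ℓ → ℝ) (i : Fin ℓ) :
    gibbs lam h (fun σ => spin σ i) =
      gibbs lam h (fun σ => Real.tanh (localField lam h i σ)) := by
  simpa using gibbs_spin_mul hℓ lam h i (g := fun _ => 1) fun _ => rfl

theorem tanh_le_gibbs_spin (hℓ : (1 : Fin ℓ) ≠ 0) {lam : ℝ} (hlam : 0 ≤ lam) (h : Fin ℓ → ℝ)
    (i : Fin ℓ) : Real.tanh (h i - 2 * lam) ≤ gibbs lam h (fun σ => spin σ i) := by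
  rw [gibbs_spin hℓ, ← gibbs_const lam h (Real.tanh (h i - 2 * lam))]
  exact gibbs_mono lam h fun σ => strictMono_tanh.monotone (sub_two_mul_le_localField hlam h i σ)

theorem gibbs_spin_le_tanh (hℓ : (1 : Fin ℓ) ≠ 0) {lam : ℝ} (hlam : 0 ≤ lam) (h : Fin ℓ → ℝ)
    (i : Fin ℓ) : gibbs lam h (fun σ => spin σ i) ≤ Real.tanh (h i + 2 * lam) := by
  rw [gibbs_spin hℓ, ← gibbs_const lam h (Real.tanh (h i + 2 * lam))]
  exact gibbs_mono lam h fun σ => strictMono_tanh.monotone (localField_le_add_two_mul hlam h i σ)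

/-- The covariance matrix of the spins. -/
def spinCov (lam : ℝ) (h : Fin ℓ → ℝ) (i j : Fin ℓ) : ℝ :=
  cov lam h (fun σ => spin σ i) (fun σ => spin σ j)

theorem spinCov_comm (lam : ℝ) (h : Fin ℓ → ℝ) (i j : Fin ℓ) :
    spinCov lam h i j = spinCov lam h j i := cov_spin_comm lam h i j

theorem spinCov_self (lam : ℝ) (h : Fin ℓ → ℝ) (i : Fin ℓ) :
    spinCov lam h i i = 1 - gibbs lam h (fun σ => spin σ i) ^ 2 := by
  unfold spinCov cov
  simp only [spin_sq, gibbs_const]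
  ring

theorem spinCov_nonneg {lam : ℝ} (hlam : 0 ≤ lam) (h : Fin ℓ → ℝ) (i j : Fin ℓ) :
    0 ≤ spinCov lam h i j := cov_nonneg hlam h (monotone_spin i) (monotone_spin j)

/-- Since `x - tanh x` is monotone, FKG bounds the covariance of `tanh` of the local field with `σ
j` by that of the local field itself. By DLR the former is `spinCov lam h i j` when `i ≠ j`; the
latter is the right-hand side. -/
theorem spinCov_le (hℓ : (1 : Fin ℓ) ≠ 0) {lam : ℝ} (hlam : 0 ≤ lam) (h : Fin ℓ → ℝ)
    {i j : Fin ℓ} (hij : i ≠ j) :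
    spinCov lam h i j ≤ lam * (spinCov lam h (i - 1) j + spinCov lam h (i + 1) j) := by
  have hmono : Monotone fun σ : Fin ℓ → ℤˣ =>
      localField lam h i σ - Real.tanh (localField lam h i σ) :=
    monotone_sub_tanh.comp fun σ τ hst => by
      have h1 := monotone_spin (i - 1) hst
      have h2 := monotone_spin (i + 1) hst
      exact add_le_add_right (mul_le_mul_of_nonneg_left (add_le_add h1 h2) hlam) _
  have h1 := cov_nonneg hlam h hmono (monotone_spin j)
  have h2 : (fun σ => (localField lam h i σ - Real.tanh (localField lam h i σ)) * spin σ j) =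
      fun σ => (h i * spin σ j + lam * (spin σ (i - 1) * spin σ j + spin σ (i + 1) * spin σ j)) -
        Real.tanh (localField lam h i σ) * spin σ j := by
    funext σ; unfold localField; ring
  have h3 : gibbs lam h (localField lam h i) = h i +
      lam * (gibbs lam h (fun σ => spin σ (i - 1)) + gibbs lam h (fun σ => spin σ (i + 1))) := by
    unfold localField
    rw [gibbs_add, gibbs_const, gibbs_const_mul, gibbs_add]
  rw [cov, h2, gibbs_sub, gibbs_sub, gibbs_add, gibbs_const_mul, gibbs_const_mul, gibbs_add, h3,
    ← gibbs_spin hℓ, ← gibbs_spin_mul hℓ lam h i fun σ => spin_flip_of_ne hij.symm σ] at h1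
  unfold spinCov cov
  linarith

/-- Summing `spinCov_le` around the cycle bounds the off-diagonal sum `S` by `2 lam (cⱼⱼ + S) ≤ 2
lam + S / 2`. -/
theorem sum_spinCov_le (hℓ : (1 : Fin ℓ) ≠ 0) {lam : ℝ} (hlam : 0 ≤ lam) (hlam' : lam ≤ 1 / 4)
    (h : Fin ℓ → ℝ) (j : Fin ℓ) :
    ∑ i ∈ Finset.univ.erase j, spinCov lam h i j ≤ 4 * lam := by
  have h1 : ∑ i ∈ Finset.univ.erase j, spinCov lam h i j ≤
      ∑ i, lam * (spinCov lam h (i - 1) j + spinCov lam h (i + 1) j) :=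
    (Finset.sum_le_sum fun i hi => spinCov_le hℓ hlam h (Finset.ne_of_mem_erase hi)).trans
      (Finset.sum_le_sum_of_subset_of_nonneg (Finset.erase_subset _ _) fun i _ _ =>
        mul_nonneg hlam (add_nonneg (spinCov_nonneg hlam h _ _) (spinCov_nonneg hlam h _ _)))
  have h2 : ∑ i, spinCov lam h (i - 1) j = ∑ i, spinCov lam h i j :=
    Equiv.sum_comp (Equiv.subRight (1 : Fin ℓ)) fun i => spinCov lam h i j
  have h3 : ∑ i, spinCov lam h (i + 1) j = ∑ i, spinCov lam h i j :=
    Equiv.sum_comp (Equiv.addRight (1 : Fin ℓ)) fun i => spinCov lam h i j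
  rw [← Finset.mul_sum, Finset.sum_add_distrib, h2, h3] at h1
  have h4 := Finset.add_sum_erase Finset.univ (fun i => spinCov lam h i j) (Finset.mem_univ j)
  have h5 : spinCov lam h j j ≤ 1 := by
    rw [spinCov_self]
    exact sub_le_self 1 (sq_nonneg _)
  have h6 : 0 ≤ ∑ i ∈ Finset.univ.erase j, spinCov lam h i j :=
    Finset.sum_nonneg fun i _ => spinCov_nonneg hlam h i j
  rw [← h4] at h1
  have h7 := mul_le_mul_of_nonneg_left h5 hlam
  have h8 := mul_le_mul_of_nonneg_right hlam' h6
  linarith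

theorem gibbs_spin_shift (lam : ℝ) (h : Fin ℓ → ℝ) (a i : Fin ℓ) :
    gibbs lam (fun k => h (k + a)) (fun σ => spin σ i) = gibbs lam h (fun σ => spin σ (i + a)) := by
  let e : (Fin ℓ → ℤˣ) ≃ (Fin ℓ → ℤˣ) :=
    Equiv.arrowCongr (Equiv.addRight a).symm (Equiv.refl ℤˣ)
  have hs : ∀ σ k, spin (e σ) k = spin σ (k + a) := fun σ k => rfl
  have hw : ∀ σ, weight lam (fun k => h (k + a)) (e σ) = weight lam h σ := by
    intro σ
    unfold weight
    congr 1
    conv_rhs => rw [← Equiv.sum_comp (Equiv.addRight a)]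
    refine Finset.sum_congr rfl fun k _ => ?_
    simp only [hs, Equiv.coe_addRight, add_right_comm]
  unfold gibbs
  rw [Z_eq_sum_weight, Z_eq_sum_weight, ← Equiv.sum_comp e,
    ← Equiv.sum_comp e (weight lam fun k => h (k + a))]
  simp only [hs, hw]

theorem exists_gibbs_spin_sub_eq (lam : ℝ) (h h' : Fin ℓ → ℝ) (i : Fin ℓ) :
    ∃ t ∈ Set.Ioo (0 : ℝ) 1,
      gibbs lam h' (fun σ => spin σ i) - gibbs lam h (fun σ => spin σ i) =
        ∑ k, (h' k - h k) * spinCov lam (fun k => h k + t * (h' k - h k)) i k := by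
  have hd : ∀ t : ℝ, HasDerivAt
      (fun t => gibbs lam (fun k => h k + t * (h' k - h k)) (fun σ => spin σ i))
      (∑ k, (h' k - h k) * spinCov lam (fun k => h k + t * (h' k - h k)) i k) t := fun t =>
    hasDerivAt_gibbs (fun k => by
      simpa using ((hasDerivAt_id' t).mul_const (h' k - h k)).const_add (h k)) _
  obtain ⟨t, ht, heq⟩ := exists_hasDerivAt_eq_slope _ _ zero_lt_one
    (fun t _ => (hd t).continuousAt.continuousWithinAt) fun t _ => hd t
  refine ⟨t, ht, ?_⟩
  simpa using heq.symm

/-- Mean value theorem on the segment between the fields. As covariances are nonnegative, a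
one-sided bound on the increments is enough. -/
theorem gibbs_spin_sub_le (hℓ : (1 : Fin ℓ) ≠ 0) {lam : ℝ} (hlam : 0 ≤ lam) (hlam' : lam ≤ 1 / 4)
    {h h' : Fin ℓ → ℝ} {δ B : ℝ} (hδ : ∀ k, h' k - h k ≤ δ) (hδ0 : 0 ≤ δ) (i : Fin ℓ)
    (hB : ∀ t ∈ Set.Ioo (0 : ℝ) 1, spinCov lam (fun k => h k + t * (h' k - h k)) i i ≤ B) :
    gibbs lam h' (fun σ => spin σ i) - gibbs lam h (fun σ => spin σ i) ≤ (B + 4 * lam) * δ := by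
  obtain ⟨t, ht, heq⟩ := exists_gibbs_spin_sub_eq lam h h' i
  rw [heq]
  set p : Fin ℓ → ℝ := fun k => h k + t * (h' k - h k)
  have h1 := Finset.add_sum_erase Finset.univ (fun k => spinCov lam p k i) (Finset.mem_univ i)
  have h2 := sum_spinCov_le hℓ hlam hlam' p i
  have h3 := hB t ht
  calc ∑ k, (h' k - h k) * spinCov lam p i k ≤ ∑ k, δ * spinCov lam p k i :=
        Finset.sum_le_sum fun k _ => by
          rw [spinCov_comm]
          exact mul_le_mul_of_nonneg_right (hδ k) (spinCov_nonneg hlam p k i)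
    _ = (∑ k, spinCov lam p k i) * δ := by rw [← Finset.mul_sum, mul_comm]
    _ ≤ (B + 4 * lam) * δ := mul_le_mul_of_nonneg_right (by linarith) hδ0

end Correlations

/-! ### First-order conditions and homogeneity of minimizers. -/

section Hamiltonian

variable {ℓ : ℕ}

theorem update_mem_fieldBox {hplus : ℝ} {h : Fin ℓ → ℝ} (hh : h ∈ fieldBox ℓ hplus)
    (j : Fin ℓ) {x : ℝ} (hx : |x| ≤ hplus) : Function.update h j x ∈ fieldBox ℓ hplus := by
  intro i
  rcases eq_or_ne i j with rfl | hij
  · simpa using hx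
  · simpa [hij] using hh i

variable [NeZero ℓ]

/-- The derivative of the free part: the quantity `hᵢ - mᵢ - h_ext`. -/
def excessField (lam hext : ℝ) (h : Fin ℓ → ℝ) (i : Fin ℓ) : ℝ :=
  h i - gibbs lam h (fun σ => spin σ i) - hext

theorem isCompact_fieldBox (ℓ : ℕ) (hplus : ℝ) : IsCompact (fieldBox ℓ hplus) := by
  have : fieldBox ℓ hplus = Set.univ.pi fun _ => Set.Icc (-hplus) hplus := by
    ext h; simp only [fieldBox, Set.mem_ofPred_eq, Set.mem_univ_pi, Set.mem_Icc, abs_le]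
  rw [this]
  exact isCompact_univ_pi fun _ => isCompact_Icc

theorem deriv_nonpos_of_isMinOn {f : ℝ → ℝ} {f' a b : ℝ} (hab : a < b)
    (hf : HasDerivAt f f' b) (hmin : ∀ x ∈ Set.Icc a b, f b ≤ f x) : f' ≤ 0 := by
  by_contra! hpos
  have h1 := (hasDerivAt_iff_tendsto_slope.1 hf).mono_left
    (nhdsWithin_mono b (fun x hx => ne_of_lt hx : Set.Iio b ⊆ {b}ᶜ))
  obtain ⟨x, hx1, hx2⟩ :=
    ((h1.eventually (lt_mem_nhds hpos)).and (Ioo_mem_nhdsLT hab)).exists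
  rw [slope_def_field] at hx1
  have h2 : f x - f b < 0 := by
    by_contra! hc
    exact absurd hx1 (not_lt.2 (div_nonpos_of_nonneg_of_nonpos hc (by linarith [hx2.2])))
  linarith [hmin x ⟨hx2.1.le, hx2.2.le⟩]

theorem deriv_nonneg_of_isMinOn {f : ℝ → ℝ} {f' a b : ℝ} (hab : a < b)
    (hf : HasDerivAt f f' a) (hmin : ∀ x ∈ Set.Icc a b, f a ≤ f x) : 0 ≤ f' := by
  have h1 : HasDerivAt (fun x => f (-x)) (-f') (-a) := by
    have h2 : HasDerivAt f f' (-(-a)) := by rwa [neg_neg]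
    exact (h2.comp (-a) (hasDerivAt_neg (-a))).congr_deriv (by ring)
  have h3 := deriv_nonpos_of_isMinOn (neg_lt_neg hab) h1 fun x hx => by
    simpa using hmin (-x) ⟨le_neg_of_le_neg hx.2, neg_le.1 hx.1⟩
  linarith

section Minimizer
variable {lam hext hplus : ℝ} {h : Fin ℓ → ℝ}

theorem sum_excessField_mul_spinCov_nonpos (hh : h ∈ fieldBox ℓ hplus)
    (hmin : IsMinOn (Heff lam hext) (fieldBox ℓ hplus) h) {j : Fin ℓ} (hj : -hplus < h j) :
    ∑ i, excessField lam hext h i * spinCov lam h i j ≤ 0 :=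
  deriv_nonpos_of_isMinOn hj (hasDerivAt_Heff_update lam hext h j) fun x hx => by
    rw [Function.update_eq_self]
    exact hmin (update_mem_fieldBox hh j (abs_le.2 ⟨hx.1, hx.2.trans (abs_le.1 (hh j)).2⟩))

theorem sum_excessField_mul_spinCov_nonneg (hh : h ∈ fieldBox ℓ hplus)
    (hmin : IsMinOn (Heff lam hext) (fieldBox ℓ hplus) h) {j : Fin ℓ} (hj : h j < hplus) :
    0 ≤ ∑ i, excessField lam hext h i * spinCov lam h i j :=
  deriv_nonneg_of_isMinOn hj (hasDerivAt_Heff_update lam hext h j) fun x hx => by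
    rw [Function.update_eq_self]
    exact hmin (update_mem_fieldBox hh j (abs_le.2 ⟨(abs_le.1 (hh j)).1.trans hx.1, hx.2⟩))

/-- Magnetizations at two sites are compared by rotating the field, which turns them into
magnetizations at one site in two fields. All fields on the segment stay above `x + 2 lam`, so the
variance `1 - m²` is at most `1 - tanh² x`. -/
theorem gibbs_spin_sub_gibbs_spin_le (hℓ : (1 : Fin ℓ) ≠ 0) (hlam : 0 ≤ lam)
    (hlam' : lam ≤ 1 / 4) {δ : ℝ} (hδ : ∀ i j, h i - h j ≤ δ) {x : ℝ} (hx : 0 ≤ x)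
    (hx' : ∀ i, x ≤ h i - 2 * lam) (i j : Fin ℓ) :
    gibbs lam h (fun σ => spin σ i) - gibbs lam h (fun σ => spin σ j) ≤
      (1 - Real.tanh x ^ 2 + 4 * lam) * δ := by
  have h1 := gibbs_spin_shift lam h (i - j) j
  rw [add_sub_cancel] at h1
  rw [← h1]
  refine gibbs_spin_sub_le hℓ hlam hlam' (fun k => hδ _ _) ((sub_self (h i)).symm.le.trans (hδ i i))
    j fun t ht => ?_
  rw [spinCov_self]
  set p : Fin ℓ → ℝ := fun k => h k + t * (h (k + (i - j)) - h k)
  have h2 : x ≤ p j - 2 * lam := by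
    have h3 := mul_le_mul_of_nonneg_left (hx' (j + (i - j))) ht.1.le
    have h4 := mul_le_mul_of_nonneg_left (hx' j) (sub_nonneg.2 ht.2.le)
    simp only [p]
    linarith
  have h5 := (strictMono_tanh.monotone h2).trans (tanh_le_gibbs_spin hℓ hlam p j)
  have h6 : 0 ≤ Real.tanh x := by simpa using strictMono_tanh.monotone hx
  linarith [pow_le_pow_left₀ h6 h5 2]

/-- Crude version without positivity of the field: the variance is at most `1`, and `1 + 4 lam ≤ 2`.
-/
theorem abs_gibbs_spin_sub_gibbs_spin_le (hℓ : (1 : Fin ℓ) ≠ 0) (hlam : 0 ≤ lam)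
    (hlam' : lam ≤ 1 / 4) {δ : ℝ} (hδ : ∀ i j, h i - h j ≤ δ) (i j : Fin ℓ) :
    |gibbs lam h (fun σ => spin σ i) - gibbs lam h (fun σ => spin σ j)| ≤ 2 * δ := by
  have hδ0 : 0 ≤ δ := (sub_self (h i)).symm.le.trans (hδ i i)
  have key : ∀ i j : Fin ℓ,
      gibbs lam h (fun σ => spin σ i) - gibbs lam h (fun σ => spin σ j) ≤ 2 * δ := by
    intro i j
    have h1 := gibbs_spin_shift lam h (i - j) j
    rw [add_sub_cancel] at h1
    rw [← h1]
    refine (gibbs_spin_sub_le hℓ hlam hlam' (B := 1) (fun k => hδ _ _) hδ0 j fun t ht => ?_).trans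
      (mul_le_mul_of_nonneg_right (by linarith) hδ0)
    rw [spinCov_self]
    exact sub_le_self 1 (sq_nonneg _)
  exact abs_sub_le_iff.2 ⟨key i j, key j i⟩

theorem abs_excessField_sub_le (hℓ : (1 : Fin ℓ) ≠ 0) (hlam : 0 ≤ lam)
    (hlam' : lam ≤ 1 / 4) {δ : ℝ} (hδ : ∀ i j, h i - h j ≤ δ) (i j : Fin ℓ) :
    |excessField lam hext h i - excessField lam hext h j| ≤ 3 * δ := by
  have h1 := abs_le.1 (abs_gibbs_spin_sub_gibbs_spin_le hℓ hlam hlam' hδ i j)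
  unfold excessField
  exact abs_le.2 ⟨by linarith [hδ j i], by linarith [hδ i j]⟩

/-- Up to an error of order `lam`, the gradient of the effective hamiltonian is diagonal. -/
theorem abs_sum_excessField_mul_spinCov_sub_le (hℓ : (1 : Fin ℓ) ≠ 0) (hlam : 0 ≤ lam)
    (hlam' : lam ≤ 1 / 4) {δ : ℝ} (hδ : ∀ i j, h i - h j ≤ δ) (j : Fin ℓ) :
    |∑ i, excessField lam hext h i * spinCov lam h i j -
      (∑ i, spinCov lam h i j) * excessField lam hext h j| ≤ 12 * lam * δ := by
  have hδ0 : 0 ≤ δ := (sub_self (h j)).symm.le.trans (hδ j j)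
  have h1 : ∑ i, excessField lam hext h i * spinCov lam h i j -
      (∑ i, spinCov lam h i j) * excessField lam hext h j =
      ∑ i ∈ Finset.univ.erase j,
        (excessField lam hext h i - excessField lam hext h j) * spinCov lam h i j := by
    rw [Finset.sum_mul, ← Finset.sum_sub_distrib, ← Finset.add_sum_erase _ _ (Finset.mem_univ j),
      mul_comm, sub_self, zero_add]
    exact Finset.sum_congr rfl fun i _ => by ring
  rw [h1]
  calc _ ≤ ∑ i ∈ Finset.univ.erase j, 3 * δ * spinCov lam h i j := by
        refine (Finset.abs_sum_le_sum_abs _ _).trans (Finset.sum_le_sum fun i _ => ?_)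
        rw [abs_mul, abs_of_nonneg (spinCov_nonneg hlam h i j)]
        exact mul_le_mul_of_nonneg_right (abs_excessField_sub_le hℓ hlam hlam' hδ i j)
          (spinCov_nonneg hlam h i j)
    _ ≤ 3 * δ * (4 * lam) := by
        rw [← Finset.mul_sum]
        exact mul_le_mul_of_nonneg_left (sum_spinCov_le hℓ hlam hlam' h j) (by positivity)
    _ = 12 * lam * δ := by ring

theorem one_sub_tanh_sq_le_sum_spinCov (hℓ : (1 : Fin ℓ) ≠ 0) (hlam : 0 ≤ lam)
    (hlam' : lam ≤ 1 / 4) (hh : h ∈ fieldBox ℓ hplus) (j : Fin ℓ) :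
    1 - Real.tanh (hplus + 1) ^ 2 ≤ ∑ i, spinCov lam h i j := by
  refine le_trans ?_ (Finset.single_le_sum (fun i _ => spinCov_nonneg hlam h i j)
    (Finset.mem_univ j))
  obtain ⟨h1, h2⟩ := abs_le.1 (hh j)
  have h3 := (gibbs_spin_le_tanh hℓ hlam h j).trans
    (strictMono_tanh.monotone (show h j + 2 * lam ≤ hplus + 1 by linarith))
  have h4 := (strictMono_tanh.monotone
    (show -(hplus + 1) ≤ h j - 2 * lam by linarith)).trans (tanh_le_gibbs_spin hℓ hlam h j)
  rw [Real.tanh_neg] at h4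
  rw [spinCov_self]
  linarith [sq_le_sq' h4 h3]

/-- For small coupling every minimizer of the effective hamiltonian over the box is
homogeneous. -/
theorem mem_homogeneousFields_of_isMinOn (hlam : 0 ≤ lam) (hlam' : lam ≤ 1 / 4)
    (hsmall : lam * (2 * (1 - Real.tanh (hplus + 1) ^ 2) + 24 * hplus) <
      (1 - Real.tanh (hplus + 1) ^ 2) * (1 / 64))
    (hsmall' : lam * (4 * (1 - Real.tanh (hplus + 1) ^ 2) + 24) <
      (1 - Real.tanh (hplus + 1) ^ 2) * Real.tanh (1 / 64) ^ 2)
    (hext0 : 1 / 32 ≤ hext) (hh : h ∈ fieldBox ℓ hplus)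
    (hmin : IsMinOn (Heff lam hext) (fieldBox ℓ hplus) h) : h ∈ homogeneousFields ℓ := by
  by_cases hℓ : (1 : Fin ℓ) = 0
  · intro i j
    have hsub : ∀ k : Fin ℓ, k = 0 := fun k => by
      have hone : ℓ = 1 := by simpa using hℓ
      subst hone
      exact Subsingleton.elim _ _
    rw [hsub i, hsub j]
  obtain ⟨M, -, hM⟩ := Finset.univ.exists_max_image h Finset.univ_nonempty
  obtain ⟨N, -, hN⟩ := Finset.univ.exists_min_image h Finset.univ_nonempty
  have hδ : ∀ i j, h i - h j ≤ h M - h N := fun i j =>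
    sub_le_sub (hM i (Finset.mem_univ i)) (hN j (Finset.mem_univ j))
  rcases (hN M (Finset.mem_univ M)).eq_or_lt with heq | hlt
  · intro i j
    have h1 := hδ i j
    have h2 := hδ j i
    linarith
  exfalso
  have hδ0 : 0 < h M - h N := sub_pos.2 hlt
  set δ := h M - h N with hδdef
  set κ := 1 - Real.tanh (hplus + 1) ^ 2 with hκdef
  have hκ : 0 < κ := sub_pos.2 (Real.tanh_sq_lt_one _)
  obtain ⟨hM1, hM2⟩ := abs_le.1 (hh M)
  obtain ⟨hN1, hN2⟩ := abs_le.1 (hh N)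
  have hDM := sum_excessField_mul_spinCov_nonpos hh hmin (hN1.trans_lt hlt)
  have hDN := sum_excessField_mul_spinCov_nonneg hh hmin (hlt.trans_le hM2)
  have hAM := (abs_le.1 (abs_sum_excessField_mul_spinCov_sub_le (hext := hext)
    hℓ hlam hlam' hδ M)).1
  have hAN := (abs_le.1 (abs_sum_excessField_mul_spinCov_sub_le (hext := hext)
    hℓ hlam hlam' hδ N)).2
  have hχM := one_sub_tanh_sq_le_sum_spinCov hℓ hlam hlam' hh M
  have hχN := one_sub_tanh_sq_le_sum_spinCov hℓ hlam hlam' hh N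
  have hε : 0 ≤ 12 * lam * δ := by positivity
  -- Only a lower bound on `χ` is available, so the sign of the excess field decides whether it is
  -- needed.
  have heM : κ * excessField lam hext h M ≤ 12 * lam * δ := by
    rcases le_total (excessField lam hext h M) 0 with h0 | h0
    · exact (mul_nonpos_of_nonneg_of_nonpos hκ.le h0).trans hε
    · linarith [mul_le_mul_of_nonneg_right hχM h0]
  have heN : -(12 * lam * δ) ≤ κ * excessField lam hext h N := by
    rcases le_total 0 (excessField lam hext h N) with h0 | h0
    · linarith [mul_nonneg hκ.le h0]
    · linarith [mul_le_mul_of_nonpos_right hχN h0]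
  -- Otherwise `h N - m N ≤ 2 lam + 1/64`, and `hext ≥ 1/32` makes the excess field at most `2 lam -
  -- 1/64`, too negative for `heN` because `δ ≤ 2 hplus`.
  have hNpos : 1 / 64 ≤ h N - 2 * lam := by
    by_contra! hc
    have h1 := tanh_le_gibbs_spin hℓ hlam h N
    have h2 := monotone_sub_tanh hc.le
    have h3 : 0 ≤ Real.tanh (1 / 64) := by
      simpa using strictMono_tanh.monotone (show (0 : ℝ) ≤ 1 / 64 by norm_num)
    simp only at h2
    have h4 : excessField lam hext h N ≤ 2 * lam - 1 / 64 := by unfold excessField; linarith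
    have h5 := mul_le_mul_of_nonneg_left h4 hκ.le
    have h6 : lam * δ ≤ lam * (2 * hplus) := mul_le_mul_of_nonneg_left (by linarith) hlam
    linarith
  have hm := gibbs_spin_sub_gibbs_spin_le hℓ hlam hlam' hδ (by norm_num) (fun i => hNpos.trans
    (sub_le_sub_right (hN i (Finset.mem_univ i)) _)) M N
  have hdiff : (Real.tanh (1 / 64) ^ 2 - 4 * lam) * δ ≤
      excessField lam hext h M - excessField lam hext h N := by
    unfold excessField; linarith
  have h7 := mul_le_mul_of_nonneg_left hdiff hκ.le
  have h8 := mul_lt_mul_of_pos_right hsmall' hδ0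
  linarith

end Minimizer

end Hamiltonian

end KacIsing

end

theorem mainTheorem4 (hplus : ℝ) (hhplus : 0 < hplus) :
    ∃ lam0 : ℝ, 0 < lam0 ∧
      ∀ lam : ℝ, 0 < lam → lam < lam0 →
      ∀ hext : ℝ, hext ∈ Set.Icc KacIsing.h0 KacIsing.hstar →
      ∀ (ℓ : ℕ) [NeZero ℓ],
        ∃ E : ℝ,
          IsGLB (KacIsing.Heff lam hext '' KacIsing.fieldBox ℓ hplus) E ∧
          IsLeast (KacIsing.Heff lam hext ''
            (KacIsing.fieldBox ℓ hplus ∩ KacIsing.homogeneousFields ℓ)) E := by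
  set κ := 1 - Real.tanh (hplus + 1) ^ 2 with hκdef
  have hκ : 0 < κ := sub_pos.2 (Real.tanh_sq_lt_one _)
  have ht : 0 < Real.tanh (1 / 64) := by
    simpa using KacIsing.strictMono_tanh (show (0 : ℝ) < 1 / 64 by norm_num)
  -- The three thresholds give `4 lam ≤ 1` for the correlation bound, the lower bound on the minimal
  -- field, and the final contradiction.
  refine ⟨min (1 / 4) (min (κ * (1 / 64) / (2 * κ + 24 * hplus))
    (κ * Real.tanh (1 / 64) ^ 2 / (4 * κ + 24))), by positivity, ?_⟩
  intro lam hlam hlt hext hhext ℓ _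
  obtain ⟨h1, h2, h3⟩ : lam < 1 / 4 ∧ lam < κ * (1 / 64) / (2 * κ + 24 * hplus) ∧
      lam < κ * Real.tanh (1 / 64) ^ 2 / (4 * κ + 24) := by simpa only [lt_min_iff] using hlt
  rw [lt_div_iff₀ (by positivity)] at h2 h3
  obtain ⟨h, hh, hmin⟩ := (KacIsing.isCompact_fieldBox ℓ hplus).exists_isMinOn
    ⟨0, fun i => by simpa using hhplus.le⟩ (KacIsing.continuous_Heff lam hext).continuousOn
  have hext0 : 1 / 32 ≤ hext := by
    have := hhext.1
    unfold KacIsing.h0 at this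
    linarith
  have hhom := KacIsing.mem_homogeneousFields_of_isMinOn hlam.le h1.le h2 h3 hext0 hh hmin
  refine ⟨KacIsing.Heff lam hext h, IsLeast.isGLB ⟨⟨h, hh, rfl⟩, ?_⟩, ⟨h, ⟨hh, hhom⟩, rfl⟩, ?_⟩
  · rintro _ ⟨k, hk, rfl⟩
    exact hmin hk
  · rintro _ ⟨k, hk, rfl⟩
    exact hmin hk.1
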